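/- Let $(\Omega,\nu)$ be an atomless standard Borel probability space. A graphon is a symmetric measurable function $W:\Omega^2\to[0,1]$. The cut norm of a bounded measurable $U:\Omega^2\to\mathbb R$ is $\|U\|_\square=\sup_{S,T}\left|\int_{S\times T}U\,d\nu^2\right|$, where $S,T$ range over the measurable subsets of $\Omega$, and the cut distance of graphons $U,W$ is $\delta_\square(U,W)=\inf_\varphi\|U-W^\varphi\|_\square$, where $\varphi$ ranges over the invertible measure-preserving maps $\Omega\to\Omega$ and $W^\varphi(x,y)=W(\varphi(x),\varphi(y))$. Let $F$ be a finite simple graph on the vertex set $[k]=\{1,\dots,k\}$. For a graphon $W$ put $W^{\otimes F}(x_1,\dots,x_k)=\prod_{i<j,\ ij\in E(F)}W(x_i,x_j)$. An $F$-tiling in $W$ is a measurable function $\mathfrak t:\Omega^k\to[0,\infty)$ which vanishes wherever $W^{\otimes F}$ vanishes and which satisfies, for every $x\in\Omega$, $$\sum_{\ell=1}^k\int_{\Omega^{k-1}}\mathfrak t(x_1,\dots,x_{\ell-1},x,x_{\ell+1},\dots,x_k)\,d\nu^{k-1}(x_1,\dots,x_{\ell-1},x_{\ell+1},\dots,x_k)\le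 1.$$ The $F$-tiling number $\mathsf{til}(F,W)$ is the supremum of $\int_{\Omega^k}\mathfrak t\,d\nu^k$ over all $F$-tilings $\mathfrak t$ in $W$. Theorem. Let $(W_n)$ be a sequence of graphons on $\Omega$ and $W$ a graphon on $\Omega$ with $\delta_\square(W_n,W)\to0$, and let $F$ be any finite simple graph on $[k]$. Then $$\liminf_{n\to\infty}\mathsf{til}(F,W_n)\ \ge\ \mathsf{til}(F,W).$$ -/

import Mathlib

open MeasureTheory Filter Topology
open scoped ENNReal NNReal

namespace GraphonTiling

/-- A graphon on the ground space `Ω`: a symmetric measurable function `Ω² → [0,1]`. -/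
structure Graphon (Ω : Type*) [MeasurableSpace Ω] where
  /-- The underlying function. -/
  toFun : Ω → Ω → ℝ
  measurable_uncurry : Measurable (fun p : Ω × Ω => toFun p.1 p.2)
  symm : ∀ x y, toFun x y = toFun y x
  mem_Icc : ∀ x y, toFun x y ∈ Set.Icc (0 : ℝ) 1

section CutDistance

variable {Ω : Type*} [MeasurableSpace Ω]

/-- The cut norm `sup_{S,T} |∫_{S×T} U dν²|` of a kernel `U`, over measurable `S, T ⊆ Ω`
(taken in `[0,∞]`, so that the supremum always exists). -/
noncomputable def cutNorm (ν : Measure Ω) (U : Ω → Ω → ℝ) : ℝ≥0∞ :=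
  ⨆ (S : Set Ω) (T : Set Ω) (_ : MeasurableSet S) (_ : MeasurableSet T),
    ENNReal.ofReal |∫ p in S ×ˢ T, U p.1 p.2 ∂(ν.prod ν)|

/-- The cut distance `inf_φ ‖U - W^φ‖_□`, where `φ` runs through the invertible measure
preserving maps `Ω → Ω` and `W^φ (x, y) = W (φ x, φ y)`. -/
noncomputable def cutDist (ν : Measure Ω) (U W : Graphon Ω) : ℝ≥0∞ :=
  ⨅ (φ : Ω ≃ᵐ Ω) (_ : MeasurePreserving φ ν ν),
    cutNorm ν (fun x y => U.toFun x y - W.toFun (φ x) (φ y))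

end CutDistance

section Tiling

variable {Ω : Type*} [MeasurableSpace Ω] {k : ℕ}

open Classical in
/-- The density `W^{⊗F}(x₁,…,x_k) = ∏_{i<j, ij ∈ E(F)} W(x_i, x_j)` of `F` in `W`. -/
noncomputable def density (F : SimpleGraph (Fin k)) (W : Graphon Ω) (x : Fin k → Ω) : ℝ :=
  ∏ e : Fin k × Fin k with e.1 < e.2 ∧ F.Adj e.1 e.2, W.toFun (x e.1) (x e.2)

/-- `t : Ω^k → [0,∞)` is an `F`-tiling in `W`. In the last field,
`lmarginal (fun _ => ν) {ℓ}ᶜ f (fun _ => x)` is the integral of `f` with respect to `ν^{k-1}`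
over all coordinates but the `ℓ`-th, the `ℓ`-th coordinate being fixed to be `x`. -/
structure IsTiling (ν : Measure Ω) (F : SimpleGraph (Fin k)) (W : Graphon Ω)
    (t : (Fin k → Ω) → ℝ≥0) : Prop where
  measurable : Measurable t
  support_subset : Function.support t ⊆ Function.support (density F W)
  sum_marginal_le_one : ∀ x : Ω,
    ∑ ℓ : Fin k, lmarginal (fun _ : Fin k => ν) ({ℓ}ᶜ : Finset (Fin k))
      (fun y => (t y : ℝ≥0∞)) (fun _ => x) ≤ 1

/-- The size `∫ t dν^k` of a tiling. -/
noncomputable def size (ν : Measure Ω) (t : (Fin k → Ω) → ℝ≥0) : ℝ≥0∞ :=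
  ∫⁻ x, (t x : ℝ≥0∞) ∂(Measure.pi fun _ : Fin k => ν)

/-- The `F`-tiling number of `W`: the supremum of the sizes of all `F`-tilings in `W`. -/
noncomputable def til (ν : Measure Ω) (F : SimpleGraph (Fin k)) (W : Graphon Ω) : ℝ≥0∞ :=
  ⨆ (t : (Fin k → Ω) → ℝ≥0) (_ : IsTiling ν F W t), size ν t

end Tiling

end GraphonTiling

namespace GraphonTiling

/-! A tiling `t` in `W` vanishes wherever `W^{⊗F}` does, so `t = s * W^{⊗F}` with `s = t / W^{⊗F}`.
Truncating `s` at a level `M` costs nothing in the limit, by monotone convergence. For `U` close to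
`W` in cut norm, the natural candidate for a tiling in `U` is `s * U^{⊗F}`: its support is
automatically right, but its marginals may exceed 1.

The counting lemma shows that `s * U^{⊗F}` and `s * W^{⊗F}` have nearly equal integrals over all
boxes. It is proved by exchanging edges one at a time for weights that are indicators of boxes, then
extended to every integrable weight (`controlsDensity_of_integrable`). Boxes with one nontrivial
side bound the `L¹` excess of the marginals over 1 (`lintegral_marginalSum_sub_one_le`), and the
full box compares the sizes.

Multiplying the candidate by `∏ w (x i)`, where `w` is the reciprocal of the load of a vertex if
that load exceeds 1 and is 1 otherwise, yields a genuine tiling. Since `s ≤ M`, the mass lost is at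
most `M * k` times the excess (`size_le_til_add`). Relabelling invariance passes from cut norm to
cut distance. -/

/-- Layer-cake bound: a weight with values in `[0,1]` may be replaced by its superlevel sets. -/
lemma abs_integral_mul_le_of_superlevel {α : Type*} [MeasurableSpace α] {μ : Measure α}
    [SFinite μ] {F K : α → ℝ} {c : ℝ} (hF : Measurable F) (hF01 : ∀ a, F a ∈ Set.Icc (0 : ℝ) 1)
    (hK : Integrable K μ) (h : ∀ t : ℝ, |∫ a in {a | t < F a}, K a ∂μ| ≤ c) :
    |∫ a, F a * K a ∂μ| ≤ c := by
  have hlayer : ∀ a, F a * K a =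
      ∫ t in Set.Ioc (0 : ℝ) 1, Set.indicator {a | t < F a} K a := by
    intro a
    have h1 : ∀ t : ℝ, Set.indicator {a | t < F a} K a = Set.indicator (Set.Iio (F a))
        (fun _ => K a) t := by
      intro t
      by_cases ht : t < F a <;> simp [ht]
    simp_rw [h1]
    rw [integral_indicator measurableSet_Iio, Measure.restrict_restrict measurableSet_Iio]
    have h2 : volume.real (Set.Iio (F a) ∩ Set.Ioc 0 1) = F a := by
      obtain ⟨h0, h1⟩ := hF01 a
      have h3 : Set.Iio (F a) ∩ Set.Ioc 0 1 = Set.Ioo 0 (F a) := by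
        ext t
        simp only [Set.mem_inter_iff, Set.mem_Iio, Set.mem_Ioc, Set.mem_Ioo]
        constructor
        · rintro ⟨h, h', -⟩; exact ⟨h', h⟩
        · rintro ⟨h', h⟩; exact ⟨h, h', by linarith⟩
      rw [h3, Real.volume_real_Ioo_of_le h0, sub_zero]
    simp [h2]
  have hint : Integrable (Function.uncurry fun (a : α) (t : ℝ) =>
      Set.indicator {a | t < F a} K a) (μ.prod (volume.restrict (Set.Ioc (0 : ℝ) 1))) := by
    have h1 : (Function.uncurry fun (a : α) (t : ℝ) => Set.indicator {a | t < F a} K a) =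
        Set.indicator {p : α × ℝ | p.2 < F p.1} (fun p => K p.1) := by
      ext ⟨a, t⟩
      simp [Function.uncurry, Set.indicator]
    rw [h1]
    exact (hK.comp_fst _).indicator (measurableSet_lt measurable_snd (hF.comp measurable_fst))
  simp_rw [hlayer]
  rw [integral_integral_swap hint]
  have h4 : ∀ t : ℝ, ∫ a, Set.indicator {a | t < F a} K a ∂μ = ∫ a in {a | t < F a}, K a ∂μ :=
    fun t => integral_indicator (measurableSet_lt measurable_const hF)
  simp_rw [h4]
  have h5 := norm_setIntegral_le_of_norm_le_const (μ := volume) (s := Set.Ioc (0 : ℝ) 1)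
    (f := fun t => ∫ a in {a | t < F a}, K a ∂μ) (C := c) (by simp) (fun t _ => h t)
  simpa using h5

/-! ### Cut norm tested against `[0,1]`-valued weights -/

section CutNorm

variable {Ω : Type*} [MeasurableSpace Ω] {ν : Measure Ω}

lemma abs_setIntegral_le_of_cutNorm_le {U : Ω → Ω → ℝ} {c : ℝ} (hc : 0 ≤ c)
    (h : cutNorm ν U ≤ ENNReal.ofReal c) {S T : Set Ω} (hS : MeasurableSet S)
    (hT : MeasurableSet T) : |∫ p in S ×ˢ T, U p.1 p.2 ∂(ν.prod ν)| ≤ c := by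
  rw [← ENNReal.ofReal_le_ofReal_iff hc]
  refine le_trans ?_ h
  exact le_iSup_of_le S (le_iSup_of_le T (le_iSup_of_le hS (le_iSup_of_le hT le_rfl)))

/-- The layer-cake bound is applied once per variable; the superlevel sets of `f` and `g` then meet
in a rectangle. -/
lemma abs_integral_mul_mul_le_of_cutNorm_le [SFinite ν] {U : Ω → Ω → ℝ} {c : ℝ} (hc : 0 ≤ c)
    (h : cutNorm ν U ≤ ENNReal.ofReal c)
    (hU : Integrable (fun p : Ω × Ω => U p.1 p.2) (ν.prod ν)) {f g : Ω → ℝ}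
    (hf : Measurable f) (hg : Measurable g) (hf01 : ∀ a, f a ∈ Set.Icc (0 : ℝ) 1)
    (hg01 : ∀ a, g a ∈ Set.Icc (0 : ℝ) 1) :
    |∫ p, f p.1 * (g p.2 * U p.1 p.2) ∂(ν.prod ν)| ≤ c := by
  have hg1 : ∀ p : Ω × Ω, ‖g p.2‖ ≤ 1 := fun p => by
    rw [Real.norm_of_nonneg (hg01 p.2).1]; exact (hg01 p.2).2
  refine abs_integral_mul_le_of_superlevel (F := fun p : Ω × Ω => f p.1)
    (hf.comp measurable_fst) (fun p => hf01 p.1)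
    (hU.bdd_mul (hg.comp measurable_snd).aestronglyMeasurable (ae_of_all _ hg1)) fun t => ?_
  refine abs_integral_mul_le_of_superlevel (F := fun p : Ω × Ω => g p.2)
    (hg.comp measurable_snd) (fun p => hg01 p.2) hU.integrableOn fun r => ?_
  have hT : MeasurableSet {p : Ω × Ω | r < g p.2} :=
    measurableSet_lt measurable_const (hg.comp measurable_snd)
  rw [Measure.restrict_restrict hT]
  have : {p : Ω × Ω | r < g p.2} ∩ {p | t < f p.1} = {a | t < f a} ×ˢ {b | r < g b} := by
    ext p
    simp [and_comm]
  rw [this]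
  exact abs_setIntegral_le_of_cutNorm_le hc h (measurableSet_lt measurable_const hf)
    (measurableSet_lt measurable_const hg)

end CutNorm

/-! ### Exchanging a single edge -/

section SingleEdge

variable {Ω : Type*} [MeasurableSpace Ω] {ν : Measure Ω} [IsProbabilityMeasure ν]
  {ι : Type*} [DecidableEq ι]

lemma measurable_update_prod (i : ι) :
    Measurable fun p : (ι → Ω) × Ω => Function.update p.1 i p.2 := by
  refine measurable_pi_lambda _ fun j => ?_
  by_cases h : j = i
  · subst h; simpa using measurable_snd
  · simp only [Function.update_of_ne h]; fun_prop

/-- Resampling a coordinate from an independent copy leaves the law unchanged. This isolates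
coordinates by Fubini without decomposing the index type. -/
lemma measurePreserving_update [Fintype ι] (i : ι) :
    MeasurePreserving (fun p : (ι → Ω) × Ω => Function.update p.1 i p.2)
      ((Measure.pi fun _ => ν).prod ν) (Measure.pi fun _ => ν) := by
  refine ⟨measurable_update_prod i, (Measure.pi_eq fun s hs => ?_).symm⟩
  rw [Measure.map_apply (measurable_update_prod i) (MeasurableSet.univ_pi hs)]
  have : (fun p : (ι → Ω) × Ω => Function.update p.1 i p.2) ⁻¹' (Set.univ.pi s) =
      (Set.univ.pi (Function.update s i Set.univ)) ×ˢ s i := by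
    ext ⟨x, a⟩
    simp only [Set.mem_preimage, Set.mem_pi, Set.mem_univ, true_imp_iff, Set.mem_prod]
    constructor
    · intro h
      refine ⟨fun j => ?_, by simpa using h i⟩
      by_cases hj : j = i
      · subst hj; simp
      · simpa [hj] using h j
    · rintro ⟨h, h'⟩ j
      by_cases hj : j = i
      · subst hj; simpa using h'
      · simpa [hj] using h j
  rw [this, Measure.prod_prod, Measure.pi_pi]
  rw [← Finset.prod_erase_mul _ _ (Finset.mem_univ i),
    ← Finset.prod_erase_mul (a := i) _ (fun i => ν (s i)) (Finset.mem_univ i)]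
  simp only [Function.update_self, measure_univ, mul_one]
  congr 1
  refine Finset.prod_congr rfl fun j hj => ?_
  rw [Function.update_of_ne (Finset.ne_of_mem_erase hj)]

lemma measurePreserving_update_update [Fintype ι] (i j : ι) :
    MeasurePreserving (fun p : (ι → Ω) × (Ω × Ω) =>
      Function.update (Function.update p.1 i p.2.1) j p.2.2)
      ((Measure.pi fun _ => ν).prod (ν.prod ν)) (Measure.pi fun _ => ν) :=
  (measurePreserving_update j).comp (((measurePreserving_update i).prod
    (MeasurePreserving.id ν)).comp ((measurePreserving_prodAssoc _ _ _).symm MeasurableEquiv.prodAssoc))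

/-- `G` is a product of two `[0,1]`-valued functions, the first of which does not depend on the
coordinate `j` and the second of which does not depend on the coordinate `i`. -/
def SplitsAt (i j : ι) (G : (ι → Ω) → ℝ) : Prop :=
  ∃ P Q : (ι → Ω) → ℝ, Measurable P ∧ Measurable Q ∧ (∀ x, P x ∈ Set.Icc (0 : ℝ) 1) ∧
    (∀ x, Q x ∈ Set.Icc (0 : ℝ) 1) ∧ (∀ x b, P (Function.update x j b) = P x) ∧
    (∀ x a, Q (Function.update x i a) = Q x) ∧ ∀ x, G x = P x * Q x

lemma SplitsAt.of_indep_right {i j : ι} {G : (ι → Ω) → ℝ} (hG : Measurable G)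
    (h01 : ∀ x, G x ∈ Set.Icc (0 : ℝ) 1) (h : ∀ x b, G (Function.update x j b) = G x) :
    SplitsAt i j G :=
  ⟨G, fun _ => 1, hG, measurable_const, h01, by simp, h, by simp, by simp⟩

lemma SplitsAt.of_indep_left {i j : ι} {G : (ι → Ω) → ℝ} (hG : Measurable G)
    (h01 : ∀ x, G x ∈ Set.Icc (0 : ℝ) 1) (h : ∀ x b, G (Function.update x i b) = G x) :
    SplitsAt i j G :=
  ⟨fun _ => 1, G, measurable_const, hG, by simp, h01, by simp, h, by simp⟩

lemma SplitsAt.mul {i j : ι} {G H : (ι → Ω) → ℝ} (hG : SplitsAt i j G) (hH : SplitsAt i j H) :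
    SplitsAt i j fun x => G x * H x := by
  obtain ⟨P, Q, hP, hQ, hP1, hQ1, hPj, hQi, h⟩ := hG
  obtain ⟨P', Q', hP', hQ', hP1', hQ1', hPj', hQi', h'⟩ := hH
  refine ⟨fun x => P x * P' x, fun x => Q x * Q' x, hP.mul hP', hQ.mul hQ',
    fun x => unitInterval.mul_mem (hP1 x) (hP1' x), fun x => unitInterval.mul_mem (hQ1 x) (hQ1' x),
    fun x b => by simp only [hPj, hPj'], fun x b => by simp only [hQi, hQi'],
    fun x => by simp only [h, h']; ring⟩

lemma SplitsAt.prod {i j : ι} {κ : Type*} (s : Finset κ) {G : κ → (ι → Ω) → ℝ}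
    (hG : ∀ e ∈ s, SplitsAt i j (G e)) : SplitsAt i j fun x => ∏ e ∈ s, G e x := by
  classical
  induction s using Finset.induction_on with
  | empty => exact .of_indep_right (by simp) (by simp) (by simp)
  | insert a s ha ih =>
    simp only [Finset.prod_insert ha]
    exact (hG a (by simp)).mul (ih fun e he => hG e (by simp [he]))

/-- Coordinates `i` and `j` are resampled. With all others frozen, `P` depends only on the new
`i`-th value and `Q` only on the new `j`-th one, so the weighted cut norm bound applies to the inner
integral. -/
lemma SplitsAt.abs_integral_mul_le [Fintype ι] {i j : ι} (hij : i ≠ j) {G : (ι → Ω) → ℝ}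
    (hG : SplitsAt i j G) {U : Ω → Ω → ℝ} {c : ℝ} (hc : 0 ≤ c)
    (h : cutNorm ν U ≤ ENNReal.ofReal c) (hU : Measurable (fun p : Ω × Ω => U p.1 p.2))
    (hU1 : ∀ x y, |U x y| ≤ 1) :
    |∫ x, G x * U (x i) (x j) ∂(Measure.pi fun _ => ν)| ≤ c := by
  obtain ⟨P, Q, hP, hQ, hP1, hQ1, hPj, hQi, hPQ⟩ := hG
  have hUi : Integrable (fun p : Ω × Ω => U p.1 p.2) (ν.prod ν) :=
    .of_bound hU.aestronglyMeasurable 1 (ae_of_all _ fun p => hU1 _ _)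
  have hmp := measurePreserving_update_update (ν := ν) i j
  have hUm : Measurable fun x : ι → Ω => U (x i) (x j) :=
    hU.comp (f := fun x : ι → Ω => (x i, x j)) (by fun_prop)
  have hm : Measurable fun x : ι → Ω => G x * U (x i) (x j) := by
    simp only [hPQ]
    exact (hP.mul hQ).mul hUm
  have hbd : ∀ x : ι → Ω, ‖G x * U (x i) (x j)‖ ≤ 1 := by
    intro x
    have h1 := unitInterval.mul_mem (hP1 x) (hQ1 x)
    rw [norm_mul, hPQ, Real.norm_of_nonneg h1.1]
    exact mul_le_one₀ h1.2 (norm_nonneg _) (hU1 _ _)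
  have hint : Integrable (fun p : (ι → Ω) × (Ω × Ω) =>
      G (Function.update (Function.update p.1 i p.2.1) j p.2.2) *
      U (Function.update (Function.update p.1 i p.2.1) j p.2.2 i)
        (Function.update (Function.update p.1 i p.2.1) j p.2.2 j))
      ((Measure.pi fun _ => ν).prod (ν.prod ν)) :=
    .of_bound (hm.comp hmp.measurable).aestronglyMeasurable 1 (ae_of_all _ fun p => hbd _)
  rw [← hmp.map_eq, integral_map hmp.measurable.aemeasurable hm.aestronglyMeasurable,
    integral_prod _ hint]
  have key : ∀ x : ι → Ω, ‖∫ p : Ω × Ω, G (Function.update (Function.update x i p.1) j p.2) *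
      U (Function.update (Function.update x i p.1) j p.2 i)
        (Function.update (Function.update x i p.1) j p.2 j) ∂(ν.prod ν)‖ ≤ c := by
    intro x
    have hx : ∀ p : Ω × Ω, G (Function.update (Function.update x i p.1) j p.2) *
      U (Function.update (Function.update x i p.1) j p.2 i)
        (Function.update (Function.update x i p.1) j p.2 j) =
        P (Function.update x i p.1) * (Q (Function.update x j p.2) * U p.1 p.2) := by
      intro p
      rw [hPQ, hPj, Function.update_comm hij, hQi, Function.update_self,
        Function.update_comm hij.symm, Function.update_self]
      ring
    simp_rw [hx]
    exact abs_integral_mul_mul_le_of_cutNorm_le hc h hUi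
      (hP.comp (measurable_update x)) (hQ.comp (measurable_update x))
      (fun _ => hP1 _) (fun _ => hQ1 _)
  simpa using norm_integral_le_of_norm_le_const (μ := Measure.pi fun _ : ι => ν)
    (ae_of_all _ key)

end SingleEdge

/-! ### Counting lemma on boxes -/

section Counting

variable {Ω : Type*} [MeasurableSpace Ω] {ν : Measure Ω} [IsProbabilityMeasure ν] {k : ℕ}

lemma Graphon.measurable_edge (U : Graphon Ω) (e : Fin k × Fin k) :
    Measurable fun x : Fin k → Ω => U.toFun (x e.1) (x e.2) :=
  U.measurable_uncurry.comp (f := fun x : Fin k → Ω => (x e.1, x e.2)) (by fun_prop)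

lemma Graphon.measurable_prod_edges (U : Graphon Ω) (E : Finset (Fin k × Fin k)) :
    Measurable fun x : Fin k → Ω => ∏ e ∈ E, U.toFun (x e.1) (x e.2) :=
  Finset.measurable_prod _ fun e _ => U.measurable_edge e

lemma Graphon.prod_edges_mem_Icc (U : Graphon Ω) (E : Finset (Fin k × Fin k)) (x : Fin k → Ω) :
    ∏ e ∈ E, U.toFun (x e.1) (x e.2) ∈ Set.Icc (0 : ℝ) 1 :=
  ⟨Finset.prod_nonneg fun _ _ => (U.mem_Icc _ _).1,
    Finset.prod_le_one (fun _ _ => (U.mem_Icc _ _).1) fun _ _ => (U.mem_Icc _ _).2⟩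

lemma Graphon.abs_sub_le_one (U W : Graphon Ω) (x y x' y' : Ω) :
    |U.toFun x y - W.toFun x' y'| ≤ 1 := by
  obtain ⟨h1, h2⟩ := U.mem_Icc x y
  obtain ⟨h3, h4⟩ := W.mem_Icc x' y'
  rw [abs_le]
  constructor <;> linarith

lemma measurable_density (F : SimpleGraph (Fin k)) (U : Graphon Ω) : Measurable (density F U) :=
  U.measurable_prod_edges _

lemma density_mem_Icc (F : SimpleGraph (Fin k)) (U : Graphon Ω) (x : Fin k → Ω) :
    density F U x ∈ Set.Icc (0 : ℝ) 1 :=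
  U.prod_edges_mem_Icc _ x

lemma abs_density_sub_le_one (F : SimpleGraph (Fin k)) (U W : Graphon Ω) (x : Fin k → Ω) :
    |density F U x - density F W x| ≤ 1 := by
  obtain ⟨h1, h2⟩ := density_mem_Icc F U x
  obtain ⟨h3, h4⟩ := density_mem_Icc F W x
  rw [abs_le]
  constructor <;> linarith

/-- Two distinct edges share at most one endpoint; the orientation hypotheses exclude the reversed
pair. -/
lemma Graphon.splitsAt_edge (U : Graphon Ω) {e e' : Fin k × Fin k} (he : e.1 < e.2)
    (he' : e'.1 < e'.2) (hne : e' ≠ e) :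
    SplitsAt e.1 e.2 fun x : Fin k → Ω => U.toFun (x e'.1) (x e'.2) := by
  by_cases h : e'.1 ≠ e.2 ∧ e'.2 ≠ e.2
  · refine .of_indep_right (U.measurable_edge e') (fun x => U.mem_Icc _ _) fun x b => ?_
    rw [Function.update_of_ne h.1, Function.update_of_ne h.2]
  · have h' : e'.1 ≠ e.1 ∧ e'.2 ≠ e.1 := by
      obtain ⟨a, b⟩ := e
      obtain ⟨a', b'⟩ := e'
      simp only [ne_eq, Prod.mk.injEq] at *
      grind
    refine .of_indep_left (U.measurable_edge e') (fun x => U.mem_Icc _ _) fun x b => ?_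
    rw [Function.update_of_ne h'.1, Function.update_of_ne h'.2]

/-- Telescoping over the edges, at cost `c` each. The weight `G` is arbitrary because the induction
absorbs the factor of the removed edge into it. -/
lemma abs_integral_mul_prod_sub_prod_le (U W : Graphon Ω) {c : ℝ} (hc : 0 ≤ c)
    (h : cutNorm ν (fun x y => U.toFun x y - W.toFun x y) ≤ ENNReal.ofReal c)
    (E : Finset (Fin k × Fin k)) (hE : ∀ e ∈ E, e.1 < e.2) (G : (Fin k → Ω) → ℝ)
    (hGm : Measurable G) (hG01 : ∀ x, G x ∈ Set.Icc (0 : ℝ) 1)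
    (hG : ∀ e ∈ E, SplitsAt e.1 e.2 G) :
    |∫ x, G x * (∏ e ∈ E, U.toFun (x e.1) (x e.2) - ∏ e ∈ E, W.toFun (x e.1) (x e.2))
      ∂(Measure.pi fun _ => ν)| ≤ E.card * c := by
  induction E using Finset.induction_on generalizing G with
  | empty => simp
  | insert e E he ih =>
    have hlt := hE e (by simp)
    have hne : ∀ e' ∈ E, e' ≠ e := fun e' h' => ne_of_mem_of_not_mem h' he
    have hsplit : ∀ x : Fin k → Ω, G x * (∏ e ∈ insert e E, U.toFun (x e.1) (x e.2)
        - ∏ e ∈ insert e E, W.toFun (x e.1) (x e.2)) =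
        (G x * U.toFun (x e.1) (x e.2)) *
          (∏ e ∈ E, U.toFun (x e.1) (x e.2) - ∏ e ∈ E, W.toFun (x e.1) (x e.2)) +
        (G x * ∏ e ∈ E, W.toFun (x e.1) (x e.2)) *
          (U.toFun (x e.1) (x e.2) - W.toFun (x e.1) (x e.2)) := by
      intro x
      rw [Finset.prod_insert he, Finset.prod_insert he]
      ring
    have hUm := U.measurable_prod_edges E
    have hWm := W.measurable_prod_edges E
    have hUe := U.measurable_edge e
    have hWe := W.measurable_edge e
    have hm1 : ∀ x : Fin k → Ω, G x * U.toFun (x e.1) (x e.2) ∈ Set.Icc (0 : ℝ) 1 :=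
      fun x => unitInterval.mul_mem (hG01 x) (U.mem_Icc _ _)
    have hm2 : ∀ x : Fin k → Ω, G x * ∏ e ∈ E, W.toFun (x e.1) (x e.2) ∈ Set.Icc (0 : ℝ) 1 :=
      fun x => unitInterval.mul_mem (hG01 x) (W.prod_edges_mem_Icc E x)
    have hi1 : Integrable (fun x : Fin k → Ω => (G x * U.toFun (x e.1) (x e.2)) *
          (∏ e ∈ E, U.toFun (x e.1) (x e.2) - ∏ e ∈ E, W.toFun (x e.1) (x e.2)))
          (Measure.pi fun _ => ν) := by
      refine .of_bound ((hGm.mul hUe).mul (hUm.sub hWm)).aestronglyMeasurable 1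
        (ae_of_all _ fun x => ?_)
      rw [norm_mul, Real.norm_of_nonneg (hm1 x).1]
      refine mul_le_one₀ (hm1 x).2 (norm_nonneg _) ?_
      have h1 := U.prod_edges_mem_Icc E x
      have h2 := W.prod_edges_mem_Icc E x
      rw [Real.norm_eq_abs, abs_le]
      constructor <;> linarith [h1.1, h1.2, h2.1, h2.2]
    have hi2 : Integrable (fun x : Fin k → Ω => (G x * ∏ e ∈ E, W.toFun (x e.1) (x e.2)) *
          (U.toFun (x e.1) (x e.2) - W.toFun (x e.1) (x e.2))) (Measure.pi fun _ => ν) := by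
      refine .of_bound ((hGm.mul hWm).mul (hUe.sub hWe)).aestronglyMeasurable 1
        (ae_of_all _ fun x => ?_)
      rw [norm_mul, Real.norm_of_nonneg (hm2 x).1]
      exact mul_le_one₀ (hm2 x).2 (norm_nonneg _) (U.abs_sub_le_one W _ _ _ _)
    simp_rw [hsplit]
    rw [integral_add hi1 hi2]
    have b1 := ih (fun e' h' => hE e' (by simp [h'])) (fun x => G x * U.toFun (x e.1) (x e.2))
      (hGm.mul hUe) hm1 fun e' h' => (hG e' (by simp [h'])).mul
        (U.splitsAt_edge (hE e' (by simp [h'])) hlt (hne e' h').symm)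
    have b2 := ((hG e (by simp)).mul (SplitsAt.prod E fun e' h' =>
      W.splitsAt_edge hlt (hE e' (by simp [h'])) (hne e' h'))).abs_integral_mul_le hlt.ne hc h
        (U.measurable_uncurry.sub W.measurable_uncurry) fun x y => U.abs_sub_le_one W _ _ _ _
    rw [Finset.card_insert_of_notMem he]
    push_cast
    refine (abs_add_le _ _).trans ?_
    linarith

lemma indicator_pi_eq_prod {α : Type*} (A : Fin k → Set α) (x : Fin k → α) :
    Set.indicator (Set.univ.pi A) (fun _ => (1 : ℝ)) x =
      ∏ i, Set.indicator (A i) (fun _ => (1 : ℝ)) (x i) := by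
  classical
  simp only [Set.indicator_apply, Finset.prod_ite_zero, Finset.prod_const_one]
  simp

/-- Counting lemma, localized to a box. -/
lemma abs_setIntegral_density_sub_le (F : SimpleGraph (Fin k)) (U W : Graphon Ω) {c : ℝ}
    (hc : 0 ≤ c)
    (h : cutNorm ν (fun x y => U.toFun x y - W.toFun x y) ≤ ENNReal.ofReal c)
    {A : Fin k → Set Ω} (hA : ∀ i, MeasurableSet (A i)) :
    |∫ x in Set.univ.pi A, (density F U x - density F W x) ∂(Measure.pi fun _ => ν)| ≤
      (k * k : ℕ) * c := by
  classical
  have hpi : MeasurableSet (Set.univ.pi A) := .univ_pi hA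
  have hi01 : ∀ i (x : Fin k → Ω), Set.indicator (A i) (fun _ => (1 : ℝ)) (x i) ∈ Set.Icc (0 : ℝ) 1 :=
    fun i x => ⟨Set.indicator_nonneg (by simp) _, Set.indicator_le_self' (by simp) _⟩
  have hmi : ∀ i, Measurable fun x : Fin k → Ω => Set.indicator (A i) (fun _ => (1 : ℝ)) (x i) :=
    fun i => (measurable_const.indicator (hA i)).comp (measurable_pi_apply i)
  have := abs_integral_mul_prod_sub_prod_le (ν := ν) U W hc h
    (Finset.univ.filter fun e : Fin k × Fin k => e.1 < e.2 ∧ F.Adj e.1 e.2)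
    (fun e he => (Finset.mem_filter.1 he).2.1)
    (fun x => ∏ i, Set.indicator (A i) (fun _ => (1 : ℝ)) (x i))
    (Finset.measurable_prod _ fun i _ => hmi i)
    (fun x => ⟨Finset.prod_nonneg fun i _ => (hi01 i x).1,
      Finset.prod_le_one (fun i _ => (hi01 i x).1) fun i _ => (hi01 i x).2⟩)
    -- A box indicator is a product of one-variable factors: the factor at `e.2` does not depend on
    -- `e.1`, and the others do not depend on `e.2`.
    (fun e he => SplitsAt.prod _ fun i _ => by
      have hlt := (Finset.mem_filter.1 he).2.1
      by_cases hi : i = e.2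
      · refine .of_indep_left (hmi i) (hi01 i) fun x b => ?_
        rw [Function.update_of_ne (hi ▸ hlt.ne')]
      · refine .of_indep_right (hmi i) (hi01 i) fun x b => ?_
        rw [Function.update_of_ne hi])
  rw [← integral_indicator hpi]
  have hcard : ((Finset.univ.filter fun e : Fin k × Fin k => e.1 < e.2 ∧ F.Adj e.1 e.2).card : ℝ)
      ≤ (k * k : ℕ) := by
    exact_mod_cast (Finset.card_le_univ _).trans (by simp)
  refine le_trans (le_of_eq ?_) (this.trans (mul_le_mul_of_nonneg_right hcard hc))
  congr 2
  ext x
  rw [← indicator_pi_eq_prod]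
  by_cases hx : x ∈ Set.univ.pi A
  · rw [Set.indicator_of_mem hx, Set.indicator_of_mem hx, one_mul]
    simp only [density]
  · rw [Set.indicator_of_notMem hx, Set.indicator_of_notMem hx, zero_mul]

end Counting

/-! ### Counting lemma for integrable weights -/

section WeightedCounting

variable {Ω : Type*} [MeasurableSpace Ω] {ν : Measure Ω} {k : ℕ}

/-- The weighted densities `s * U^{⊗F}` converge to `s * W^{⊗F}`, uniformly over all boxes, as the
graphon `U` tends to `W` in the cut norm. -/
def ControlsDensity (ν : Measure Ω) (F : SimpleGraph (Fin k)) (W : Graphon Ω)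
    (s : (Fin k → Ω) → ℝ) : Prop :=
  ∀ ε > 0, ∃ δ > 0, ∀ U : Graphon Ω,
    cutNorm ν (fun x y => U.toFun x y - W.toFun x y) ≤ ENNReal.ofReal δ →
    ∀ A : Fin k → Set Ω, (∀ i, MeasurableSet (A i)) →
      |∫ x in Set.univ.pi A, s x * (density F U x - density F W x) ∂(Measure.pi fun _ => ν)| ≤ ε

variable {F : SimpleGraph (Fin k)} {W : Graphon Ω}

lemma integrable_mul_density_sub {s : (Fin k → Ω) → ℝ} {μ : Measure (Fin k → Ω)}
    (hs : Integrable s μ) (U : Graphon Ω) :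
    Integrable (fun x => s x * (density F U x - density F W x)) μ :=
  hs.mul_bdd (c := 1) ((measurable_density F U).sub (measurable_density F W)).aestronglyMeasurable
    (ae_of_all _ fun x => abs_density_sub_le_one F U W x)

lemma ControlsDensity.const_mul {s : (Fin k → Ω) → ℝ} (h : ControlsDensity ν F W s) (a : ℝ) :
    ControlsDensity ν F W fun x => a * s x := by
  intro ε hε
  obtain ⟨δ, hδ, H⟩ := h (ε / (|a| + 1)) (by positivity)
  refine ⟨δ, hδ, fun U hU A hA => ?_⟩
  simp_rw [mul_assoc]
  rw [integral_const_mul, abs_mul]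
  calc _ ≤ (|a| + 1) * (ε / (|a| + 1)) :=
        mul_le_mul (by linarith) (H U hU A hA) (abs_nonneg _) (by positivity)
    _ = ε := by field_simp

lemma ControlsDensity.add {s t : (Fin k → Ω) → ℝ} (hs : ControlsDensity ν F W s)
    (ht : ControlsDensity ν F W t) (his : Integrable s (Measure.pi fun _ => ν))
    (hit : Integrable t (Measure.pi fun _ => ν)) :
    ControlsDensity ν F W fun x => s x + t x := by
  intro ε hε
  obtain ⟨δ, hδ, H⟩ := hs (ε / 2) (by positivity)
  obtain ⟨δ', hδ', H'⟩ := ht (ε / 2) (by positivity)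
  refine ⟨min δ δ', lt_min hδ hδ', fun U hU A hA => ?_⟩
  simp_rw [add_mul]
  rw [integral_add (integrable_mul_density_sub his.integrableOn U)
    (integrable_mul_density_sub hit.integrableOn U)]
  have h1 := H U (hU.trans (ENNReal.ofReal_le_ofReal (min_le_left _ _))) A hA
  have h2 := H' U (hU.trans (ENNReal.ofReal_le_ofReal (min_le_right _ _))) A hA
  exact (abs_add_le _ _).trans (by linarith)

/-- Densities differ by at most 1 pointwise, so an `L¹` error in the weight carries over uniformly
in `U` and in the box. -/
lemma ControlsDensity.of_approx {s : (Fin k → Ω) → ℝ}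
    (his : Integrable s (Measure.pi fun _ => ν))
    (h : ∀ ε > 0, ∃ t : (Fin k → Ω) → ℝ, ControlsDensity ν F W t ∧
      Integrable t (Measure.pi fun _ => ν) ∧ ∫ x, |s x - t x| ∂(Measure.pi fun _ => ν) ≤ ε) :
    ControlsDensity ν F W s := by
  intro ε hε
  obtain ⟨t, ht, hit, hst⟩ := h (ε / 2) (by positivity)
  obtain ⟨δ, hδ, H⟩ := ht (ε / 2) (by positivity)
  refine ⟨δ, hδ, fun U hU A hA => ?_⟩
  have hdiff : Integrable (fun x => s x - t x) (Measure.pi fun _ => ν) := his.sub hit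
  have hsplit : ∀ x, s x * (density F U x - density F W x) =
      t x * (density F U x - density F W x) + (s x - t x) * (density F U x - density F W x) :=
    fun x => by ring
  simp_rw [hsplit]
  rw [integral_add (integrable_mul_density_sub hit.integrableOn U)
    (integrable_mul_density_sub hdiff.integrableOn U)]
  have h2 : |∫ x in Set.univ.pi A, (s x - t x) * (density F U x - density F W x)
      ∂(Measure.pi fun _ => ν)| ≤ ε / 2 := by
    rw [← Real.norm_eq_abs]
    refine (norm_integral_le_of_norm_le hdiff.abs.integrableOn (ae_of_all _ fun x => ?_)).trans
      ((setIntegral_le_integral hdiff.abs (ae_of_all _ fun x => abs_nonneg _)).trans hst)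
    rw [norm_mul]
    exact mul_le_of_le_one_right (norm_nonneg _) (abs_density_sub_le_one F U W x)
  exact (abs_add_le _ _).trans (by linarith [H U hU A hA])

variable [IsProbabilityMeasure ν]

lemma controlsDensity_indicator_pi {B : Fin k → Set Ω} (hB : ∀ i, MeasurableSet (B i)) :
    ControlsDensity ν F W (Set.indicator (Set.univ.pi B) fun _ => 1) := by
  intro ε hε
  -- The `+ 1` keeps the denominator positive when `k = 0`.
  refine ⟨ε / ((k * k : ℕ) + 1), by positivity, fun U hU A hA => ?_⟩
  have h1 : ∀ x, Set.indicator (Set.univ.pi B) (fun _ => (1 : ℝ)) x *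
      (density F U x - density F W x) =
      Set.indicator (Set.univ.pi B) (fun x => density F U x - density F W x) x := by
    intro x
    by_cases hx : x ∈ Set.univ.pi B
    · simp [Set.indicator_of_mem hx]
    · simp [Set.indicator_of_notMem hx]
  simp_rw [h1]
  rw [setIntegral_indicator (.univ_pi hB), ← Set.pi_inter_distrib]
  refine (abs_setIntegral_density_sub_le F U W (by positivity) hU
    (fun i => (hA i).inter (hB i))).trans ?_
  calc _ ≤ (((k * k : ℕ) : ℝ) + 1) * (ε / ((k * k : ℕ) + 1)) := by gcongr; linarith
    _ = ε := by field_simp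

/-- Dynkin's π-λ argument from boxes; a countable disjoint union is approximated in `L¹` by its
finite partial unions. -/
lemma controlsDensity_indicator {S : Set (Fin k → Ω)} (hS : MeasurableSet S) :
    ControlsDensity ν F W (Set.indicator S fun _ => 1) := by
  have hint : ∀ {S : Set (Fin k → Ω)}, MeasurableSet S →
      Integrable (Set.indicator S fun _ => (1 : ℝ)) (Measure.pi fun _ => ν) :=
    fun hS => (integrable_const _).indicator hS
  refine MeasurableSpace.induction_on_inter
    (C := fun S _ => ControlsDensity ν F W (Set.indicator S fun _ => 1))
    generateFrom_pi.symm isPiSystem_pi ?_ ?_ ?_ ?_ S hS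
  · intro ε hε
    exact ⟨1, one_pos, fun U _ A _ => by simpa using hε.le⟩
  · rintro _ ⟨B, hB, rfl⟩
    exact controlsDensity_indicator_pi fun i => hB i trivial
  · intro t ht ih
    have h1 := (controlsDensity_indicator_pi (ν := ν) (F := F) (W := W)
      (B := fun _ => Set.univ) fun _ => .univ).add (ih.const_mul (-1)) (hint (by simp))
        ((hint ht).const_mul (-1))
    convert h1 using 2 with x
    by_cases hx : x ∈ t <;> simp [hx]
  · intro f hdisj hf ih
    have hacc : ∀ n, MeasurableSet (Set.accumulate f n) :=
      fun n => .biUnion (Set.to_countable _) fun i _ => hf i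
    refine .of_approx (hint (.iUnion hf)) fun ε hε => ?_
    have hlim : Tendsto (fun n => (Measure.pi fun _ => ν).real (Set.accumulate f n)) atTop
        (𝓝 ((Measure.pi fun _ => ν).real (⋃ i, f i))) :=
      (ENNReal.tendsto_toReal (measure_ne_top _ _)).comp tendsto_measure_iUnion_accumulate
    obtain ⟨n, hn⟩ := (hlim.eventually (lt_mem_nhds (sub_lt_self _ hε))).exists
    refine ⟨Set.indicator (Set.accumulate f n) fun _ => 1, ?_, hint (hacc n), ?_⟩
    · clear hn
      induction n with
      | zero => simpa using ih 0
      | succ n ihn =>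
        rw [Set.accumulate_succ, Set.indicator_union_of_disjoint
          (Set.disjoint_accumulate hdisj (Nat.lt_succ_self n))]
        exact ihn.add (ih _) (hint (hacc n)) (hint (hf _))
    · have hsub : Set.accumulate f n ⊆ ⋃ i, f i := Set.accumulate_subset_iUnion n
      have h1 : ∀ x, |Set.indicator (⋃ i, f i) (fun _ => (1 : ℝ)) x -
          Set.indicator (Set.accumulate f n) (fun _ => 1) x| =
          Set.indicator ((⋃ i, f i) \ Set.accumulate f n) (fun _ => 1) x := by
        intro x
        by_cases hx : x ∈ Set.accumulate f n
        · rw [Set.indicator_of_mem hx, Set.indicator_of_mem (hsub hx)]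
          simp [hx]
        · rw [Set.indicator_of_notMem hx]
          by_cases hx' : x ∈ ⋃ i, f i
          · rw [Set.indicator_of_mem hx', Set.indicator_of_mem (Set.mem_sdiff_of_mem hx' hx)]; simp
          · rw [Set.indicator_of_notMem hx', Set.indicator_of_notMem fun h => hx' h.1]; simp
      simp_rw [h1]
      rw [integral_indicator_const _ ((MeasurableSet.iUnion hf).diff (hacc n)),
        measureReal_sdiff hsub (hacc n)]
      simp only [smul_eq_mul, mul_one]
      linarith

/-- Counting lemma with an arbitrary integrable weight. -/
theorem controlsDensity_of_integrable {s : (Fin k → Ω) → ℝ}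
    (hs : Integrable s (Measure.pi fun _ => ν)) : ControlsDensity ν F W s := by
  refine Integrable.induction (ControlsDensity ν F W) ?_ ?_ ?_ ?_ hs
  · intro c S hS _
    convert (controlsDensity_indicator (ν := ν) (F := F) (W := W) hS).const_mul c using 2 with x
    by_cases hx : x ∈ S <;> simp [hx]
  · intro f g _ hf hg ihf ihg
    exact ihf.add ihg hf hg
  · refine isClosed_of_closure_subset fun f hf => .of_approx (L1.integrable_coeFn f) fun ε hε => ?_
    obtain ⟨g, hg, hfg⟩ := Metric.mem_closure_iff.1 hf ε hε
    refine ⟨g, hg, L1.integrable_coeFn g, ?_⟩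
    rw [dist_eq_norm, L1.norm_eq_integral_norm] at hfg
    refine le_trans (le_of_eq (integral_congr_ae ?_)) hfg.le
    filter_upwards [Lp.coeFn_sub f g] with x hx
    simp only [hx, Pi.sub_apply, Real.norm_eq_abs]
  · intro f g hfg hf ihf
    refine .of_approx (hf.congr hfg) fun ε hε => ⟨_, ihf, hf, ?_⟩
    rw [integral_eq_zero_of_ae]
    · exact hε.le
    · filter_upwards [hfg] with x hx
      simp [hx]

end WeightedCounting

/-! ### Marginals, and trimming a function to a tiling -/

section Marginals

variable {Ω : Type*} [MeasurableSpace Ω] {ν : Measure Ω} {k : ℕ}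

/-- The sum over all coordinates of the one-dimensional marginals of `f`. -/
noncomputable def marginalSum (ν : Measure Ω) (f : (Fin k → Ω) → ℝ≥0∞) (a : Ω) : ℝ≥0∞ :=
  ∑ ℓ : Fin k, lmarginal (fun _ : Fin k => ν) ({ℓ}ᶜ : Finset (Fin k)) f (fun _ => a)

lemma marginalSum_mono {f g : (Fin k → Ω) → ℝ≥0∞} (h : f ≤ g) (a : Ω) :
    marginalSum ν f a ≤ marginalSum ν g a :=
  Finset.sum_le_sum fun _ _ => lmarginal_mono h _

lemma lmarginal_weight {f : (Fin k → Ω) → ℝ≥0∞} (hf : Measurable f) (w : Ω → ℝ≥0∞)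
    (ℓ : Fin k) (a : Ω) :
    lmarginal (fun _ : Fin k => ν) ({ℓ}ᶜ : Finset (Fin k)) (fun x => w (x ℓ) * f x)
      (fun _ => a) =
    w a * lmarginal (fun _ : Fin k => ν) ({ℓ}ᶜ : Finset (Fin k)) f (fun _ => a) := by
  simp only [lmarginal]
  rw [← lintegral_const_mul (w a) (f := fun y => f (Function.updateFinset (fun _ => a) {ℓ}ᶜ y))
    (hf.comp measurable_updateFinset)]
  refine lintegral_congr fun y => ?_
  congr 2
  simp [Function.updateFinset]

variable [IsProbabilityMeasure ν]

lemma measurable_lmarginal_diag {f : (Fin k → Ω) → ℝ≥0∞} (hf : Measurable f) (ℓ : Fin k) :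
    Measurable fun a : Ω =>
      lmarginal (fun _ : Fin k => ν) ({ℓ}ᶜ : Finset (Fin k)) f (fun _ => a) :=
  (hf.lmarginal (fun _ : Fin k => ν)).comp (measurable_pi_lambda _ fun _ => measurable_id)

lemma measurable_marginalSum {f : (Fin k → Ω) → ℝ≥0∞} (hf : Measurable f) :
    Measurable (marginalSum ν f) :=
  Finset.measurable_sum _ fun ℓ _ => measurable_lmarginal_diag hf ℓ

/-- The marginal over `{ℓ}ᶜ` reads only the `ℓ`-th coordinate of its argument, so evaluating it at a
constant function is harmless and Fubini applies. -/
lemma lintegral_lmarginal_diag {f : (Fin k → Ω) → ℝ≥0∞} (hf : Measurable f) (ℓ : Fin k) :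
    ∫⁻ a, lmarginal (fun _ : Fin k => ν) ({ℓ}ᶜ : Finset (Fin k)) f (fun _ => a) ∂ν =
      ∫⁻ x, f x ∂(Measure.pi fun _ => ν) := by
  obtain ⟨x₀⟩ : Nonempty (Fin k → Ω) := by
    have := nonempty_of_isProbabilityMeasure ν
    infer_instance
  rw [lintegral_eq_lmarginal_univ x₀, ← Finset.union_compl ({ℓ} : Finset (Fin k)),
    lmarginal_union _ f hf disjoint_compl_right, lmarginal_singleton]
  refine lintegral_congr fun a => lmarginal_congr _ f fun i hi => ?_
  have : i = ℓ := by simpa using hi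
  subst this
  simp

lemma setLIntegral_lmarginal_diag {f : (Fin k → Ω) → ℝ≥0∞} (hf : Measurable f) (ℓ : Fin k)
    {A : Set Ω} (hA : MeasurableSet A) :
    ∫⁻ a in A, lmarginal (fun _ : Fin k => ν) ({ℓ}ᶜ : Finset (Fin k)) f (fun _ => a) ∂ν =
      ∫⁻ x in Function.eval ℓ ⁻¹' A, f x ∂(Measure.pi fun _ => ν) := by
  have hA' : MeasurableSet (Function.eval ℓ ⁻¹' A : Set (Fin k → Ω)) := measurable_pi_apply ℓ hA
  have hw : Measurable (A.indicator fun _ => (1 : ℝ≥0∞)) := measurable_const.indicator hA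
  rw [← lintegral_indicator hA, ← lintegral_indicator hA']
  have h := lintegral_lmarginal_diag (ν := ν)
    (f := fun x : Fin k → Ω => A.indicator (fun _ => (1 : ℝ≥0∞)) (x ℓ) * f x)
    ((hw.comp (measurable_pi_apply ℓ)).mul hf) ℓ
  simp_rw [lmarginal_weight hf] at h
  convert h using 1
  · refine lintegral_congr fun a => ?_
    by_cases ha : a ∈ A <;> simp [ha]
  · refine lintegral_congr fun x => ?_
    by_cases hx : x ℓ ∈ A
    · rw [Set.indicator_of_mem (show x ∈ Function.eval ℓ ⁻¹' A from hx)]; simp [hx]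
    · rw [Set.indicator_of_notMem (show x ∉ Function.eval ℓ ⁻¹' A from hx)]; simp [hx]

lemma setLIntegral_marginalSum {f : (Fin k → Ω) → ℝ≥0∞} (hf : Measurable f) {A : Set Ω}
    (hA : MeasurableSet A) :
    ∫⁻ a in A, marginalSum ν f a ∂ν =
      ∑ ℓ : Fin k, ∫⁻ x in Function.eval ℓ ⁻¹' A, f x ∂(Measure.pi fun _ => ν) := by
  simp only [marginalSum]
  rw [lintegral_finsetSum _ fun ℓ _ => measurable_lmarginal_diag hf ℓ]
  exact Finset.sum_congr rfl fun ℓ _ => setLIntegral_lmarginal_diag hf ℓ hA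

/-- The excess lives on the set `A` where the marginal sum of `f` is at least 1. Its integral over
`A` splits into `k` integrals over slabs `x ℓ ∈ A`, which are boxes, each costing `ε`. -/
lemma lintegral_marginalSum_sub_one_le {f g : (Fin k → Ω) → ℝ≥0∞} (hf : Measurable f)
    (hg : Measurable g) {ε : ℝ≥0∞}
    (h : ∀ A : Fin k → Set Ω, (∀ i, MeasurableSet (A i)) →
      ∫⁻ x in Set.univ.pi A, f x ∂(Measure.pi fun _ => ν) ≤
        ∫⁻ x in Set.univ.pi A, g x ∂(Measure.pi fun _ => ν) + ε)
    (hg1 : ∀ a, marginalSum ν g a ≤ 1) :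
    ∫⁻ a, (marginalSum ν f a - 1) ∂ν ≤ k * ε := by
  have hm := measurable_marginalSum (ν := ν) hf
  set A : Set Ω := {a | 1 ≤ marginalSum ν f a} with hAdef
  have hA : MeasurableSet A := measurableSet_le measurable_const hm
  have h1 : ∀ a, marginalSum ν f a - 1 = A.indicator (fun a => marginalSum ν f a - 1) a := by
    intro a
    by_cases ha : a ∈ A
    · rw [Set.indicator_of_mem ha]
    · rw [Set.indicator_of_notMem ha]
      exact tsub_eq_zero_of_le (not_le.1 ha).le
  rw [lintegral_congr h1, lintegral_indicator hA, lintegral_sub measurable_const (by simp)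
    ((ae_restrict_mem hA).mono fun a ha => ha), tsub_le_iff_right]
  calc ∫⁻ a in A, marginalSum ν f a ∂ν
      = ∑ ℓ : Fin k, ∫⁻ x in Function.eval ℓ ⁻¹' A, f x ∂(Measure.pi fun _ => ν) :=
        setLIntegral_marginalSum hf hA
    _ ≤ ∑ ℓ : Fin k, (∫⁻ x in Function.eval ℓ ⁻¹' A, g x ∂(Measure.pi fun _ => ν) + ε) := by
        refine Finset.sum_le_sum fun ℓ _ => ?_
        rw [← Set.univ_pi_update_univ]
        refine h _ fun i => ?_
        by_cases hi : i = ℓ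
        · subst hi; simpa using hA
        · simp [Function.update_of_ne hi]
    _ = k * ε + ∫⁻ a in A, marginalSum ν g a ∂ν := by
        rw [Finset.sum_add_distrib, ← setLIntegral_marginalSum hg hA]
        simp [add_comm]
    _ ≤ k * ε + ∫⁻ _ in A, 1 ∂ν := by
        gcongr with a
        exact hg1 a

/-- The union bound `1 - ∏ w ≤ ∑ (1 - w)`, in a form free of subtraction. -/
lemma one_le_prod_add_sum {ι : Type*} (s : Finset ι) {w d : ι → ℝ≥0∞} (hw : ∀ i, w i ≤ 1)
    (h : ∀ i, 1 ≤ w i + d i) : 1 ≤ ∏ i ∈ s, w i + ∑ i ∈ s, d i := by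
  classical
  induction s using Finset.induction_on with
  | empty => simp
  | insert a s ha ih =>
    rw [Finset.prod_insert ha, Finset.sum_insert ha]
    calc 1 ≤ w a * 1 + d a := by simpa using h a
      _ ≤ w a * (∏ i ∈ s, w i + ∑ i ∈ s, d i) + d a := by gcongr
      _ ≤ w a * ∏ i ∈ s, w i + 1 * ∑ i ∈ s, d i + d a := by
          rw [mul_add]
          gcongr
          exact hw a
      _ = _ := by ring

lemma one_le_inv_max_add_sub (m : ℝ≥0∞) : 1 ≤ (max 1 m)⁻¹ + (m - 1) := by
  rcases le_total m 1 with h | h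
  · simp [h]
  · rw [max_eq_right h]
    rcases eq_or_ne m ⊤ with rfl | htop
    · simp
    have h0 : m ≠ 0 := (zero_lt_one.trans_le h).ne'
    calc (1 : ℝ≥0∞) = m⁻¹ * (1 + (m - 1)) := by
          rw [add_tsub_cancel_of_le h, ENNReal.inv_mul_cancel h0 htop]
      _ ≤ m⁻¹ + 1 * (m - 1) := by
          rw [mul_add, mul_one]
          gcongr
          exact ENNReal.inv_le_one.2 h
      _ = _ := by rw [one_mul]

/-- A bounded function supported on copies of `F` can be scaled down to a tiling, at a cost
controlled by the excess of its marginals over `1`. -/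
lemma size_le_til_add {F : SimpleGraph (Fin k)} {U : Graphon Ω} {t : (Fin k → Ω) → ℝ≥0}
    (ht : Measurable t) (hsupp : Function.support t ⊆ Function.support (density F U)) {M : ℝ≥0}
    (hM : ∀ x, t x ≤ M) :
    size ν t ≤ til ν F U +
      M * (k * ∫⁻ a, (marginalSum ν (fun x => (t x : ℝ≥0∞)) a - 1) ∂ν) := by
  set m := marginalSum ν (fun x => (t x : ℝ≥0∞)) with hm
  have htm : Measurable fun x => (t x : ℝ≥0∞) := ht.coe_nnreal_ennreal
  have hmm : Measurable m := measurable_marginalSum htm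
  have hw1 : ∀ a, (max 1 (m a))⁻¹ ≤ 1 := fun a => ENNReal.inv_le_one.2 (le_max_left _ _)
  set w : Ω → ℝ≥0 := fun a => ((max 1 (m a))⁻¹).toNNReal with hw
  have hwc : ∀ a, (w a : ℝ≥0∞) = (max 1 (m a))⁻¹ := fun a =>
    ENNReal.coe_toNNReal (ne_top_of_le_ne_top ENNReal.one_ne_top (hw1 a))
  have hwm : Measurable w := (measurable_const.max hmm).inv.ennreal_toNNReal
  set t' : (Fin k → Ω) → ℝ≥0 := fun x => t x * ∏ i, w (x i) with ht'
  -- Keeping only the `ℓ`-th factor suffices to bound the `ℓ`-th marginal: the load at `a` becomes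
  -- at most `w a * m a ≤ 1`, for every `a`.
  have hle : ∀ ℓ x, (t' x : ℝ≥0∞) ≤ w (x ℓ) * t x := by
    intro ℓ x
    norm_cast
    have h1 : ∏ i ∈ Finset.univ.erase ℓ, w (x i) ≤ 1 := Finset.prod_le_one' fun i _ => by
      have := hw1 (x i)
      rw [← hwc] at this
      exact_mod_cast this
    calc t' x = w (x ℓ) * t x * ∏ i ∈ Finset.univ.erase ℓ, w (x i) := by
          simp only [ht']
          rw [← Finset.mul_prod_erase _ _ (Finset.mem_univ ℓ)]
          ring
      _ ≤ w (x ℓ) * t x := mul_le_of_le_one_right' h1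
  have htil : IsTiling ν F U t' := by
    refine ⟨ht.mul (Finset.measurable_prod _ fun i _ => hwm.comp (measurable_pi_apply i)),
      fun x hx => hsupp fun h => hx (by simp [ht', h]), fun a => ?_⟩
    calc _ ≤ ∑ ℓ : Fin k, lmarginal (fun _ : Fin k => ν) ({ℓ}ᶜ : Finset (Fin k))
            (fun x => (w (x ℓ) : ℝ≥0∞) * t x) (fun _ => a) :=
          Finset.sum_le_sum fun ℓ _ => lmarginal_mono (hle ℓ) _
      _ = w a * m a := by
          rw [hm, marginalSum, Finset.mul_sum]
          exact Finset.sum_congr rfl fun ℓ _ => lmarginal_weight htm (fun b => (w b : ℝ≥0∞)) ℓ a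
      _ ≤ (max 1 (m a))⁻¹ * max 1 (m a) := by
          rw [hwc]
          gcongr
          exact le_max_right _ _
      _ ≤ 1 := ENNReal.inv_mul_le_one _
  have hpt : ∀ x, (t x : ℝ≥0∞) ≤ t' x + M * ∑ i, (m (x i) - 1) := by
    intro x
    have h1 := one_le_prod_add_sum Finset.univ (w := fun i => (w (x i) : ℝ≥0∞))
      (d := fun i => m (x i) - 1) (fun i => (hwc _).trans_le (hw1 _))
      (fun i => by simpa only [hwc] using one_le_inv_max_add_sub _)
    calc (t x : ℝ≥0∞) = t x * 1 := (mul_one _).symm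
      _ ≤ t x * (∏ i, (w (x i) : ℝ≥0∞) + ∑ i, (m (x i) - 1)) := by gcongr
      _ = t' x + t x * ∑ i, (m (x i) - 1) := by
          rw [mul_add]
          simp [ht']
      _ ≤ _ := by
          gcongr
          exact hM x
  have hmi : ∀ i : Fin k, Measurable fun x : Fin k → Ω => m (x i) - 1 :=
    fun i => (hmm.sub measurable_const).comp (measurable_pi_apply i)
  calc size ν t ≤ ∫⁻ x, (t' x + M * ∑ i, (m (x i) - 1)) ∂(Measure.pi fun _ => ν) :=
        lintegral_mono hpt
    _ = size ν t' + M * (k * ∫⁻ a, (m a - 1) ∂ν) := by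
        rw [lintegral_add_left htil.measurable.coe_nnreal_ennreal,
          lintegral_const_mul _ (Finset.measurable_sum _ fun i _ => hmi i),
          lintegral_finsetSum _ fun i _ => hmi i]
        have h2 : ∀ i : Fin k, ∫⁻ x : Fin k → Ω, (m (x i) - 1) ∂(Measure.pi fun _ => ν) =
            ∫⁻ a, (m a - 1) ∂ν := fun i =>
          (measurePreserving_eval (fun _ : Fin k => ν) i).lintegral_comp
            (hmm.sub measurable_const)
        simp [h2, size]
    _ ≤ _ := by
        gcongr
        exact le_iSup₂_of_le t' htil le_rfl

end Marginals

/-! ### Invariance under relabelling -/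

section Relabel

variable {Ω : Type*} [MeasurableSpace Ω] {ν : Measure Ω} {k : ℕ}

/-- The graphon `W^ψ (x, y) = W (ψ x, ψ y)`. -/
def Graphon.relabel (W : Graphon Ω) (ψ : Ω ≃ᵐ Ω) : Graphon Ω where
  toFun x y := W.toFun (ψ x) (ψ y)
  measurable_uncurry := W.measurable_uncurry.comp (f := fun p : Ω × Ω => (ψ p.1, ψ p.2))
    ((ψ.measurable.comp measurable_fst).prodMk (ψ.measurable.comp measurable_snd))
  symm _ _ := W.symm _ _
  mem_Icc _ _ := W.mem_Icc _ _

lemma cutNorm_comp_le [SFinite ν] (K : Ω → Ω → ℝ) {ψ : Ω ≃ᵐ Ω} (hψ : MeasurePreserving ψ ν ν) :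
    cutNorm ν (fun x y => K (ψ x) (ψ y)) ≤ cutNorm ν K := by
  refine iSup_le fun S => iSup_le fun T => iSup_le fun hS => iSup_le fun hT => ?_
  have hmp : MeasurePreserving (ψ.prodCongr ψ) (ν.prod ν) (ν.prod ν) := hψ.prod hψ
  have h1 := hmp.setIntegral_preimage_emb (ψ.prodCongr ψ).measurableEmbedding
    (fun p => K p.1 p.2) ((ψ.symm ⁻¹' S) ×ˢ (ψ.symm ⁻¹' T))
  have h2 : (ψ.prodCongr ψ) ⁻¹' ((ψ.symm ⁻¹' S) ×ˢ (ψ.symm ⁻¹' T)) = S ×ˢ T := by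
    ext p
    change ψ.symm (ψ p.1) ∈ S ∧ ψ.symm (ψ p.2) ∈ T ↔ _
    simp
  rw [h2] at h1
  change ENNReal.ofReal |∫ p in S ×ˢ T, K ((ψ.prodCongr ψ) p).1 ((ψ.prodCongr ψ) p).2
    ∂(ν.prod ν)| ≤ _
  rw [h1]
  exact le_iSup_of_le _ (le_iSup_of_le _ (le_iSup_of_le (ψ.symm.measurable hS)
    (le_iSup_of_le (ψ.symm.measurable hT) le_rfl)))

/-- The cut distance relabels the limit graphon, whereas the weight `s` is tied to a fixed `W`. The
relabelling is therefore undone on `Wseq n`, whose tilings are transported along `φ`. -/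
lemma til_relabel_symm_le [SigmaFinite ν] (F : SimpleGraph (Fin k)) (W : Graphon Ω) {φ : Ω ≃ᵐ Ω}
    (hφ : MeasurePreserving φ ν ν) : til ν F (W.relabel φ.symm) ≤ til ν F W := by
  refine iSup₂_le fun t ht => ?_
  have hmap : Measurable fun x : Fin k → Ω => fun i => φ (x i) :=
    measurable_pi_lambda _ fun i => φ.measurable.comp (measurable_pi_apply i)
  have htil : IsTiling ν F W fun x => t fun i => φ (x i) := by
    refine ⟨ht.measurable.comp hmap, fun x hx => ?_, fun a => ?_⟩
    · have := ht.support_subset (Function.mem_support.2 hx)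
      simpa [Function.mem_support, density, Graphon.relabel] using this
    · refine le_trans (le_of_eq (Finset.sum_congr rfl fun ℓ _ => ?_))
        (ht.sum_marginal_le_one (φ a))
      simp only [lmarginal]
      rw [← (measurePreserving_pi (fun _ : (({ℓ}ᶜ : Finset (Fin k)) : Type) => ν) (fun _ => ν)
        (fun _ => hφ)).lintegral_comp (f := fun y => (t (Function.updateFinset (fun _ => φ a)
          ({ℓ}ᶜ : Finset (Fin k)) y) : ℝ≥0∞))
          (ht.measurable.coe_nnreal_ennreal.comp measurable_updateFinset)]
      refine lintegral_congr fun y => ?_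
      congr 2
      ext i
      by_cases hi : i ∈ ({ℓ}ᶜ : Finset (Fin k)) <;> simp [Function.updateFinset, hi]
  have hsize : size ν t = size ν fun x => t fun i => φ (x i) :=
    ((measurePreserving_pi (fun _ : Fin k => ν) (fun _ => ν) (fun _ => hφ)).lintegral_comp
      ht.measurable.coe_nnreal_ennreal).symm
  rw [hsize]
  exact le_iSup₂_of_le _ htil le_rfl

end Relabel

/-! ### Lower semicontinuity -/

section Semicontinuity

variable {Ω : Type*} [MeasurableSpace Ω] {ν : Measure Ω} {k : ℕ}

/-- The function `s * U^{⊗F}`. -/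
noncomputable def weightedDensity (F : SimpleGraph (Fin k)) (U : Graphon Ω)
    (s : (Fin k → Ω) → ℝ≥0) (x : Fin k → Ω) : ℝ≥0 :=
  s x * (density F U x).toNNReal

lemma measurable_weightedDensity (F : SimpleGraph (Fin k)) (U : Graphon Ω)
    {s : (Fin k → Ω) → ℝ≥0} (hs : Measurable s) : Measurable (weightedDensity F U s) :=
  hs.mul (measurable_density F U).real_toNNReal

lemma coe_weightedDensity (F : SimpleGraph (Fin k)) (U : Graphon Ω) (s : (Fin k → Ω) → ℝ≥0)
    (x : Fin k → Ω) : (weightedDensity F U s x : ℝ) = s x * density F U x := by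
  simp [weightedDensity, Real.coe_toNNReal _ (density_mem_Icc F U x).1]

lemma weightedDensity_le (F : SimpleGraph (Fin k)) (U : Graphon Ω) {s : (Fin k → Ω) → ℝ≥0}
    {M : ℝ≥0} (hM : ∀ x, s x ≤ M) (x : Fin k → Ω) : weightedDensity F U s x ≤ M := by
  refine le_trans (mul_le_of_le_one_right' ?_) (hM x)
  exact Real.toNNReal_le_one.2 (density_mem_Icc F U x).2

variable [IsProbabilityMeasure ν]

lemma setLIntegral_weightedDensity_le {F : SimpleGraph (Fin k)} {U W : Graphon Ω}
    {s : (Fin k → Ω) → ℝ≥0} (hs : Measurable s) {M : ℝ≥0} (hM : ∀ x, s x ≤ M) {ε : ℝ≥0}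
    {B : Set (Fin k → Ω)}
    (h : |∫ x in B, s x * (density F U x - density F W x) ∂(Measure.pi fun _ => ν)| ≤ ε) :
    ∫⁻ x in B, (weightedDensity F U s x : ℝ≥0∞) ∂(Measure.pi fun _ => ν) ≤
      ∫⁻ x in B, (weightedDensity F W s x : ℝ≥0∞) ∂(Measure.pi fun _ => ν) + ε := by
  have hint : ∀ V : Graphon Ω, Integrable (fun x => (weightedDensity F V s x : ℝ))
      ((Measure.pi fun _ => ν).restrict B) := fun V =>
    .of_bound (measurable_weightedDensity F V hs).coe_nnreal_real.aestronglyMeasurable M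
      (ae_of_all _ fun x => by
        rw [Real.norm_of_nonneg (NNReal.coe_nonneg _)]
        exact_mod_cast weightedDensity_le F V hM x)
  have hconv : ∀ V : Graphon Ω,
      ∫⁻ x in B, (weightedDensity F V s x : ℝ≥0∞) ∂(Measure.pi fun _ => ν) =
      ENNReal.ofReal (∫ x in B, (weightedDensity F V s x : ℝ) ∂(Measure.pi fun _ => ν)) := by
    intro V
    rw [ofReal_integral_eq_lintegral_ofReal (hint V) (ae_of_all _ fun x => NNReal.coe_nonneg _)]
    simp
  have hsub : ∫ x in B, s x * (density F U x - density F W x) ∂(Measure.pi fun _ => ν) =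
      ∫ x in B, (weightedDensity F U s x : ℝ) ∂(Measure.pi fun _ => ν) -
      ∫ x in B, (weightedDensity F W s x : ℝ) ∂(Measure.pi fun _ => ν) := by
    rw [← integral_sub (hint U) (hint W)]
    simp_rw [coe_weightedDensity, mul_sub]
  rw [hsub] at h
  rw [hconv, hconv, ← ENNReal.ofReal_coe_nnreal, ← ENNReal.ofReal_add
    (integral_nonneg fun x => NNReal.coe_nonneg _) (NNReal.coe_nonneg _)]
  exact ENNReal.ofReal_le_ofReal (by linarith [(abs_le.1 h).2])

lemma exists_forall_size_le_til_add {F : SimpleGraph (Fin k)} {W : Graphon Ω}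
    {s : (Fin k → Ω) → ℝ≥0} (hs : Measurable s) {M : ℝ≥0} (hM : ∀ x, s x ≤ M)
    (hmarg : ∀ a, marginalSum ν (fun x => (weightedDensity F W s x : ℝ≥0∞)) a ≤ 1)
    {ε : ℝ≥0} (hε : 0 < ε) :
    ∃ δ > 0, ∀ U : Graphon Ω,
      cutNorm ν (fun x y => U.toFun x y - W.toFun x y) ≤ ENNReal.ofReal δ →
      size ν (weightedDensity F W s) ≤ til ν F U + ε := by
  -- Comparing the sizes costs `η`; trimming costs `M * k` times an excess of at most `k * η`.
  set η : ℝ≥0 := ε / (1 + M * (k * k)) with hη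
  have hηpos : 0 < η := by positivity
  have hsi : Integrable (fun x => (s x : ℝ)) (Measure.pi fun _ => ν) :=
    .of_bound hs.coe_nnreal_real.aestronglyMeasurable M (ae_of_all _ fun x => by
      rw [Real.norm_of_nonneg (NNReal.coe_nonneg _)]
      exact_mod_cast hM x)
  obtain ⟨δ, hδ, H⟩ := controlsDensity_of_integrable (F := F) (W := W) hsi η hηpos
  refine ⟨δ, hδ, fun U hU => ?_⟩
  have hsize : size ν (weightedDensity F W s) ≤ size ν (weightedDensity F U s) + η := by
    have h1 := H U hU (fun _ => Set.univ) fun _ => .univ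
    -- The sizes are compared in the direction opposite to the marginals, so `U` and `W` swap roles.
    rw [← abs_neg, ← integral_neg] at h1
    simp_rw [← mul_neg, neg_sub] at h1
    simpa [size] using setLIntegral_weightedDensity_le hs hM h1
  have hexc := lintegral_marginalSum_sub_one_le (ν := ν)
    (measurable_weightedDensity F U hs).coe_nnreal_ennreal
    (measurable_weightedDensity F W hs).coe_nnreal_ennreal
    (fun A hA => setLIntegral_weightedDensity_le hs hM (H U hU A hA)) hmarg
  have htil := size_le_til_add (ν := ν) (F := F) (U := U) (measurable_weightedDensity F U hs)
    (fun x hx h => hx (by simp [weightedDensity, h])) (weightedDensity_le F U hM)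
  calc size ν (weightedDensity F W s)
      ≤ til ν F U + M * (k * (k * η)) + η := by
        refine hsize.trans ?_
        gcongr
        refine htil.trans ?_
        gcongr
    _ = til ν F U + ((1 + M * (k * k)) * η : ℝ≥0) := by
        push_cast
        ring
    _ = til ν F U + ε := by
        congr 2
        rw [hη]
        field_simp

lemma size_weightedDensity_le_liminf {F : SimpleGraph (Fin k)} {W : Graphon Ω}
    {Wseq : ℕ → Graphon Ω} (hW : Tendsto (fun n => cutDist ν (Wseq n) W) atTop (𝓝 0))
    {s : (Fin k → Ω) → ℝ≥0} (hs : Measurable s) {M : ℝ≥0} (hM : ∀ x, s x ≤ M)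
    (hmarg : ∀ a, marginalSum ν (fun x => (weightedDensity F W s x : ℝ≥0∞)) a ≤ 1) :
    size ν (weightedDensity F W s) ≤ liminf (fun n => til ν F (Wseq n)) atTop := by
  refine ENNReal.le_of_forall_pos_le_add fun ε hε _ => ?_
  obtain ⟨δ, hδ, H⟩ := exists_forall_size_le_til_add hs hM hmarg hε
  rw [← tsub_le_iff_right]
  refine le_liminf_of_le (by isBoundedDefault) ?_
  filter_upwards [hW.eventually (gt_mem_nhds (ENNReal.ofReal_pos.2 hδ))] with n hn
  simp only [cutDist, iInf_lt_iff] at hn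
  obtain ⟨φ, hφ, hlt⟩ := hn
  rw [tsub_le_iff_right]
  refine (H ((Wseq n).relabel φ.symm) ?_).trans
    (add_le_add_left (til_relabel_symm_le F (Wseq n) hφ) _)
  refine le_trans (le_of_eq ?_) ((cutNorm_comp_le _ hφ.symm).trans hlt.le)
  simp [Graphon.relabel]

/-- The `F`-tiling number is lower semicontinuous with respect to the cut distance. -/
theorem til_le_liminf_til (F : SimpleGraph (Fin k)) {Wseq : ℕ → Graphon Ω} {W : Graphon Ω}
    (hW : Tendsto (fun n => cutDist ν (Wseq n) W) atTop (𝓝 0)) :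
    til ν F W ≤ liminf (fun n => til ν F (Wseq n)) atTop := by
  refine iSup₂_le fun t ht => ?_
  have hq : Measurable fun x => t x / (density F W x).toNNReal :=
    ht.measurable.div (measurable_density F W).real_toNNReal
  set s : ℕ → (Fin k → Ω) → ℝ≥0 := fun M x => min (t x / (density F W x).toNNReal) M with hsdef
  have hs : ∀ M, Measurable (s M) := fun M => hq.min measurable_const
  -- Where the density vanishes the quotient is 0 by convention, which is consistent since `t`
  -- vanishes there too.
  have hcancel : ∀ x, t x / (density F W x).toNNReal * (density F W x).toNNReal = t x := by
    intro x
    rcases eq_or_ne (density F W x).toNNReal 0 with h0 | h0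
    · have hd : density F W x = 0 :=
        le_antisymm (Real.toNNReal_eq_zero.1 h0) (density_mem_Icc F W x).1
      have htx : t x = 0 := by
        by_contra h
        exact ht.support_subset h hd
      simp [htx]
    · exact div_mul_cancel₀ _ h0
  have hle : ∀ M x, weightedDensity F W (s M) x ≤ t x := fun M x => by
    rw [← hcancel x, weightedDensity]
    gcongr
    exact min_le_left _ _
  have hlim : Tendsto (fun M => size ν (weightedDensity F W (s M))) atTop (𝓝 (size ν t)) := by
    refine lintegral_tendsto_of_tendsto_of_monotone
      (fun M => (measurable_weightedDensity F W (hs M)).coe_nnreal_ennreal.aemeasurable)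
      (ae_of_all _ fun x M N hMN => ?_) (ae_of_all _ fun x => ?_)
    · simp only [weightedDensity, hsdef]
      gcongr
    · refine tendsto_const_nhds.congr' ?_
      -- At each point the truncation is inactive once `M` exceeds the quotient.
      filter_upwards [eventually_ge_atTop ⌈t x / (density F W x).toNNReal⌉₊] with M hM
      simp only [weightedDensity, hsdef]
      rw [min_eq_left (Nat.ceil_le.1 hM), hcancel]
  refine le_of_tendsto' hlim fun M => ?_
  refine size_weightedDensity_le_liminf hW (hs M) (M := M) (fun x => min_le_right _ _) fun a => ?_
  refine (marginalSum_mono (fun x => ?_) a).trans (ht.sum_marginal_le_one a)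
  exact ENNReal.coe_le_coe.2 (hle M x)

end Semicontinuity

end GraphonTiling

theorem theorem3p7 {Ω : Type*} [MeasurableSpace Ω] [StandardBorelSpace Ω]
    (ν : Measure Ω) [IsProbabilityMeasure ν] [NullSingletonClass ν]
    {k : ℕ} (F : SimpleGraph (Fin k))
    (Wseq : ℕ → GraphonTiling.Graphon Ω) (W : GraphonTiling.Graphon Ω)
    (hW : Tendsto (fun n => GraphonTiling.cutDist ν (Wseq n) W) atTop (𝓝 0)) :
    GraphonTiling.til ν F W ≤ liminf (fun n => GraphonTiling.til ν F (Wseq n)) atTop := by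
  exact GraphonTiling.til_le_liminf_til F hW
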